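/- Let $(X,d)$ be a positive definite metric space, i.e. for every finite $F\subset X$ the matrix $(e^{-d(x,y)})_{x,y\in F}$ is (strictly) positive definite. Let $\mathcal W_X$ be the Hilbert space completion of the space of finitely supported signed measures on $X$ with respect to the inner product $$\Big\langle \sum_x u_x\delta_x,\ \sum_y v_y\delta_y\Big\rangle_{\mathcal W_X}=\sum_{x,y}u_xv_y\,e^{-d(x,y)} .$$ For a nonempty finite set $F\subset X$, the maximum diversity is $$|F|_+=\max\Big\{\frac{(\sum_{x} w_x)^2}{\sum_{x,y}w_xw_y\,e^{-d(x,y)}}\ :\ w=\sum_{x\in F}w_x\delta_x\neq 0,\ w_x\ge 0\Big\},$$ and the diversifier $w_{F,+}$ is the maximizer normalized by $\sum_x w_x=|F|_+$. For a nonempty compact set $A\subset X$ put $|A|_+=\sup\{|F|_+ : F\subset A \text{ nonempty and finite}\}\in[0,\infty]$, and let the diversifier $w_{A,+}\in\mathcal W_X$ be the limit of the net $(w_{F,+})_F$ over the finite subsets $F$ of $A$, directed by inclusion. Let $\mathcal C_X$ be the space of nonempty compact subsets of $X$ with the Hausdorff metric $d_H$. These notions are well defined: for nonempty finite $F$ the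 maximum is attained and the diversifier exists and is unique, and for every $A\in\mathcal C_X$ one has $|A|_+<\infty$ and the net defining $w_{A,+}$ converges in $\mathcal W_X$. Moreover, for all $A,B\in\mathcal C_X$, $$\|w_{A,+}-w_{B,+}\|_{\mathcal W_X}\le 4\sqrt2\,|A\cup B|_+\,d_H(A,B)^{1/2}.$$ Consequently, if $|\cdot|_+:\mathcal C_X\to[0,\infty]$ is continuous at $A\in\mathcal C_X$, then the diversifier map $\mathcal C_X\to\mathcal W_X$, $B\mapsto w_{B,+}$, is continuous at $A$, and it is Hölder continuous with exponent $1/2$ on some neighbourhood of $A$. -/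

import Mathlib

open Set Filter Topology TopologicalSpace
open scoped ENNReal NNReal

/-- The similarity matrix `(e^{-d(x,y)})_{x,y ∈ F}` of a finite subset `F` of a metric space. -/
noncomputable def similarityMatrix {X : Type*} [MetricSpace X] (F : Finset X) : Matrix F F ℝ :=
  Matrix.of fun x y => Real.exp (-dist (x : X) (y : X))

/-- A metric space is positive definite if the similarity matrix of each of its finite subsets
is (strictly) positive definite. -/
class PositiveDefiniteSpace (X : Type*) [MetricSpace X] : Prop where
  posDef : ∀ F : Finset X, (similarityMatrix F).PosDef

/-- The form `⟨∑ uₓ δₓ, ∑ v_y δ_y⟩ = ∑ₓ ∑_y uₓ v_y e^{-d(x,y)}` on finitely supported signed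
measures. A finitely supported signed measure `∑ wₓ δₓ` is encoded by the finitely supported
function `x ↦ wₓ`. -/
noncomputable def similarityForm {X : Type*} [MetricSpace X] (u v : X →₀ ℝ) : ℝ :=
  u.sum fun x a => v.sum fun y b => a * b * Real.exp (-dist x y)

theorem similarityForm_comm {X : Type*} [MetricSpace X] (u v : X →₀ ℝ) :
    similarityForm u v = similarityForm v u := by
  unfold similarityForm
  rw [Finsupp.sum_comm]
  refine Finsupp.sum_congr fun x _ => Finsupp.sum_congr fun y _ => ?_
  rw [dist_comm, mul_comm (u y)]

theorem similarityForm_add_left {X : Type*} [MetricSpace X] (u v w : X →₀ ℝ) :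
    similarityForm (u + v) w = similarityForm u w + similarityForm v w := by
  unfold similarityForm
  rw [Finsupp.sum_add_index']
  · intro x; simp
  · intro x a b
    rw [← Finsupp.sum_add]
    refine Finsupp.sum_congr fun y _ => ?_
    ring

theorem similarityForm_smul_left {X : Type*} [MetricSpace X] (r : ℝ) (u v : X →₀ ℝ) :
    similarityForm (r • u) v = r * similarityForm u v := by
  unfold similarityForm
  rw [Finsupp.sum_smul_index' (fun x => by simp), Finsupp.mul_sum]
  refine Finsupp.sum_congr fun x _ => ?_
  rw [Finsupp.mul_sum]
  refine Finsupp.sum_congr fun y _ => ?_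
  simp only [smul_eq_mul]
  ring

theorem similarityForm_self_pos {X : Type*} [MetricSpace X] [PositiveDefiniteSpace X]
    {w : X →₀ ℝ} (hw : w ≠ 0) : 0 < similarityForm w w := by
  classical
  have hne : w.subtypeDomain (fun x => x ∈ w.support) ≠ 0 := by
    intro h
    apply hw
    ext x
    by_cases hx : x ∈ w.support
    · simpa using DFunLike.congr_fun h ⟨x, hx⟩
    · simpa using hx
  have h := (PositiveDefiniteSpace.posDef (X := X) w.support).2 hne
  have key : ∀ g : X → ℝ → ℝ,
      (w.subtypeDomain (fun x => x ∈ w.support)).sum (fun i a => g i a) = w.sum g := fun g =>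
    Finsupp.sum_subtypeDomain_index (h := g) (fun x hx => hx)
  have e : similarityForm w w = (w.subtypeDomain (fun x => x ∈ w.support)).sum fun i xi =>
      (w.subtypeDomain (fun x => x ∈ w.support)).sum fun j xj =>
        star xi * similarityMatrix w.support i j * xj := by
    unfold similarityForm
    rw [← key]
    refine Finsupp.sum_congr fun x _ => ?_
    rw [← key]
    refine Finsupp.sum_congr fun y _ => ?_
    simp [similarityMatrix]
    ring
  rw [e]
  exact h

/-- The space of finitely supported signed measures on `X`, to be normed by `similarityForm`. -/
def FiniteMeasures (X : Type*) : Type _ := X →₀ ℝ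

/-- The identity map onto the type synonym `FiniteMeasures X`. -/
def FiniteMeasures.of {X : Type*} (w : X →₀ ℝ) : FiniteMeasures X := w

noncomputable instance (X : Type*) : AddCommGroup (FiniteMeasures X) :=
  inferInstanceAs (AddCommGroup (X →₀ ℝ))

noncomputable instance (X : Type*) : Module ℝ (FiniteMeasures X) :=
  inferInstanceAs (Module ℝ (X →₀ ℝ))

/-- `similarityForm` is an inner product on the finitely supported signed measures. -/
noncomputable abbrev FiniteMeasures.core (X : Type*) [MetricSpace X] [PositiveDefiniteSpace X] :
    InnerProductSpace.Core ℝ (FiniteMeasures X) where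
  inner u v := similarityForm (X := X) u v
  conj_inner_symm u v := similarityForm_comm (X := X) v u
  re_inner_nonneg u := by
    by_cases h : u = 0
    · subst h
      have h0 : similarityForm (0 : X →₀ ℝ) 0 = 0 := by simp [similarityForm]
      exact h0.ge
    · exact (similarityForm_self_pos (X := X) h).le
  add_left u v w := similarityForm_add_left (X := X) u v w
  smul_left u v r := similarityForm_smul_left (X := X) r u v
  definite u h := by
    by_contra hu
    exact (similarityForm_self_pos (X := X) hu).ne' h

noncomputable instance (X : Type*) [MetricSpace X] [PositiveDefiniteSpace X] :
    NormedAddCommGroup (FiniteMeasures X) :=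
  @InnerProductSpace.Core.toNormedAddCommGroup ℝ (FiniteMeasures X) _ _ _ (FiniteMeasures.core X)

noncomputable instance (X : Type*) [MetricSpace X] [PositiveDefiniteSpace X] :
    InnerProductSpace ℝ (FiniteMeasures X) :=
  InnerProductSpace.ofCore (FiniteMeasures.core X).toCore

/-- The weighting space of `X`: the Hilbert space completion of the finitely supported signed
measures. -/
abbrev WeightingSpace (X : Type*) [MetricSpace X] [PositiveDefiniteSpace X] : Type _ :=
  UniformSpace.Completion (FiniteMeasures X)

/-- A finitely supported signed measure as an element of the weighting space. -/
noncomputable def toWeightingSpace {X : Type*} [MetricSpace X] [PositiveDefiniteSpace X]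
    (w : X →₀ ℝ) : WeightingSpace X :=
  (FiniteMeasures.of w : UniformSpace.Completion (FiniteMeasures X))

/-- The total mass `∑ₓ wₓ`. -/
noncomputable def totalMass {X : Type*} (w : X →₀ ℝ) : ℝ := w.sum fun _ a => a

/-- The objective `(∑ₓ wₓ)² / ∑ₓ ∑_y wₓ w_y e^{-d(x,y)}`. -/
noncomputable def diversityRatio {X : Type*} [MetricSpace X] (w : X →₀ ℝ) : ℝ :=
  totalMass w ^ 2 / similarityForm w w

/-- The nonzero nonnegative measures supported in the finite set `F`. -/
def feasibleMeasures {X : Type*} (F : Finset X) : Set (X →₀ ℝ) :=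
  {w | w ≠ 0 ∧ w.support ⊆ F ∧ ∀ x, 0 ≤ w x}

/-- The maximum diversity of a finite set `F`: the largest value of `diversityRatio` on the nonzero
nonnegative measures supported in `F` (for `F = ∅` it is `0`). -/
noncomputable def finiteMaxDiversity {X : Type*} [MetricSpace X] (F : Finset X) : ℝ :=
  sSup (diversityRatio '' feasibleMeasures F)

/-- `w` is a diversifier of the finite set `F`: it maximizes `diversityRatio` among the nonzero
nonnegative measures supported in `F`, and its total mass is the maximum diversity of `F`. -/
def IsFiniteDiversifier {X : Type*} [MetricSpace X] (F : Finset X) (w : X →₀ ℝ) : Prop :=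
  w ∈ feasibleMeasures F ∧ IsMaxOn diversityRatio (feasibleMeasures F) w ∧
    totalMass w = finiteMaxDiversity F

open Classical in
/-- The diversifier of a finite set (`0` for the empty set, which has no feasible measure). -/
noncomputable def finiteDiversifier {X : Type*} [MetricSpace X] (F : Finset X) : X →₀ ℝ :=
  if h : ∃ w, IsFiniteDiversifier F w then h.choose else 0

/-- The maximum diversity of a subset `A` of `X`: the supremum in `[0, ∞]` of the maximum
diversities of the finite subsets of `A`. -/
noncomputable def maxDiversity {X : Type*} [MetricSpace X] (A : Set X) : ℝ≥0∞ :=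
  ⨆ (F : Finset X) (_ : (F : Set X) ⊆ A), ENNReal.ofReal (finiteMaxDiversity F)

/-- The net of the diversifiers of the finite subsets of `A`, in the weighting space of `X`. -/
noncomputable def diversifierNet {X : Type*} [MetricSpace X] [PositiveDefiniteSpace X]
    (A : Set X) (F : Finset A) : WeightingSpace X :=
  toWeightingSpace (finiteDiversifier (F.map (Function.Embedding.subtype _)))

/-- The diversifier of `A`: the limit of the diversifiers of the finite subsets of `A`, directed
by inclusion. -/
noncomputable def diversifier {X : Type*} [MetricSpace X] [PositiveDefiniteSpace X]
    (A : Set X) : WeightingSpace X :=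
  limUnder atTop (diversifierNet A)

section SimilarityForm

variable {X : Type*} [MetricSpace X]

theorem similarityForm_add_right (u v w : X →₀ ℝ) :
    similarityForm u (v + w) = similarityForm u v + similarityForm u w := by
  rw [similarityForm_comm, similarityForm_add_left, similarityForm_comm v, similarityForm_comm w]

theorem similarityForm_smul_right (r : ℝ) (u v : X →₀ ℝ) :
    similarityForm u (r • v) = r * similarityForm u v := by
  rw [similarityForm_comm, similarityForm_smul_left, similarityForm_comm]

theorem similarityForm_add_self (u v : X →₀ ℝ) :
    similarityForm (u + v) (u + v) =
      similarityForm u u + 2 * similarityForm u v + similarityForm v v := by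
  rw [similarityForm_add_left, similarityForm_add_right, similarityForm_add_right,
    similarityForm_comm v u]
  ring

theorem similarityForm_sub_self (u v : X →₀ ℝ) :
    similarityForm (u - v) (u - v) =
      similarityForm u u - 2 * similarityForm u v + similarityForm v v := by
  have h : u - v = u + (-1 : ℝ) • v := by simp [sub_eq_add_neg]
  rw [h, similarityForm_add_self, similarityForm_smul_right, similarityForm_smul_right,
    similarityForm_smul_left]
  ring

theorem similarityForm_eq_sum {F : Finset X} {w : X →₀ ℝ} (hw : w.support ⊆ F) :
    similarityForm w w = ∑ x ∈ F, ∑ y ∈ F, w x * w y * Real.exp (-dist x y) := by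
  unfold similarityForm
  rw [Finsupp.sum_of_support_subset _ hw _ (by simp)]
  refine Finset.sum_congr rfl fun x _ => ?_
  rw [Finsupp.sum_of_support_subset _ hw _ (by simp)]

theorem similarityForm_mapDomain (π : X → X) (w : X →₀ ℝ) :
    similarityForm (w.mapDomain π) (w.mapDomain π) =
      w.sum fun x a => w.sum fun y b => a * b * Real.exp (-dist (π x) (π y)) := by
  unfold similarityForm
  rw [Finsupp.sum_mapDomain_index]
  · refine Finsupp.sum_congr fun x _ => ?_
    rw [Finsupp.sum_mapDomain_index]
    · simp
    · intro y a b; ring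
  · simp
  · intro x a b
    rw [← Finsupp.sum_add]
    refine Finsupp.sum_congr fun y _ => ?_
    ring

/-- Moving each point of a nonnegative measure by at most `r` increases its energy by a factor of
at most `e^{2r}`. -/
theorem similarityForm_mapDomain_le {π : X → X} {w : X →₀ ℝ} {r : ℝ} (hw : ∀ x, 0 ≤ w x)
    (hπ : ∀ x ∈ w.support, dist x (π x) ≤ r) :
    similarityForm (w.mapDomain π) (w.mapDomain π) ≤ Real.exp (2 * r) * similarityForm w w := by
  rw [similarityForm_mapDomain, similarityForm, Finsupp.mul_sum]
  refine Finset.sum_le_sum fun x hx => ?_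
  beta_reduce
  rw [Finsupp.mul_sum]
  refine Finset.sum_le_sum fun y hy => ?_
  have h : Real.exp (-dist (π x) (π y)) ≤ Real.exp (2 * r) * Real.exp (-dist x y) := by
    rw [← Real.exp_add, Real.exp_le_exp]
    have h₁ := dist_triangle4 x (π x) (π y) y
    have h₂ := hπ x hx
    have h₃ := hπ y hy
    rw [dist_comm] at h₃
    linarith
  calc w x * w y * Real.exp (-dist (π x) (π y))
      ≤ w x * w y * (Real.exp (2 * r) * Real.exp (-dist x y)) :=
        mul_le_mul_of_nonneg_left h (mul_nonneg (hw x) (hw y))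
    _ = Real.exp (2 * r) * (w x * w y * Real.exp (-dist x y)) := by ring

end SimilarityForm

section TotalMass

variable {X : Type*}

theorem totalMass_add (u v : X →₀ ℝ) : totalMass (u + v) = totalMass u + totalMass v :=
  Finsupp.sum_add_index' (by simp) (by simp)

theorem totalMass_smul (r : ℝ) (u : X →₀ ℝ) : totalMass (r • u) = r * totalMass u := by
  unfold totalMass
  rw [Finsupp.sum_smul_index' (by simp), Finsupp.mul_sum]
  rfl

theorem totalMass_mapDomain (π : X → X) (w : X →₀ ℝ) :
    totalMass (w.mapDomain π) = totalMass w :=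
  Finsupp.sum_mapDomain_index (by simp) (by simp)

theorem totalMass_eq_sum {F : Finset X} {w : X →₀ ℝ} (hw : w.support ⊆ F) :
    totalMass w = ∑ x ∈ F, w x :=
  Finsupp.sum_of_support_subset _ hw _ (by simp)

theorem totalMass_pos {F : Finset X} {w : X →₀ ℝ} (hw : w ∈ feasibleMeasures F) :
    0 < totalMass w := by
  obtain ⟨h0, -, hn⟩ := hw
  refine Finset.sum_pos (fun x hx => (hn x).lt_of_ne' (Finsupp.mem_support_iff.1 hx)) ?_
  exact Finsupp.support_nonempty_iff.2 h0

theorem ne_zero_of_totalMass_pos {w : X →₀ ℝ} (hw : 0 < totalMass w) : w ≠ 0 := by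
  rintro rfl
  simp [totalMass] at hw

theorem feasibleMeasures_mono {F G : Finset X} (h : F ⊆ G) :
    feasibleMeasures F ⊆ feasibleMeasures G :=
  fun _ hw => ⟨hw.1, hw.2.1.trans h, hw.2.2⟩

theorem feasibleMeasures_empty : feasibleMeasures (∅ : Finset X) = ∅ := by
  ext w
  simp only [feasibleMeasures, Finset.subset_empty, Finsupp.support_eq_empty, mem_ofPred_eq,
    mem_empty_iff_false, iff_false]
  exact fun h => h.1 h.2.1

theorem nonempty_of_mem_feasibleMeasures {F : Finset X} {w : X →₀ ℝ}
    (hw : w ∈ feasibleMeasures F) : F.Nonempty := by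
  rw [Finset.nonempty_iff_ne_empty]
  rintro rfl
  simp [feasibleMeasures_empty] at hw

theorem add_mem_feasibleMeasures {F : Finset X} {u v : X →₀ ℝ} (hu : u ∈ feasibleMeasures F)
    (hv : v ∈ feasibleMeasures F) : u + v ∈ feasibleMeasures F := by
  classical
  refine ⟨ne_zero_of_totalMass_pos ?_, ?_, fun x => add_nonneg (hu.2.2 x) (hv.2.2 x)⟩
  · rw [totalMass_add]
    exact add_pos (totalMass_pos hu) (totalMass_pos hv)
  · exact Finsupp.support_add.trans (Finset.union_subset hu.2.1 hv.2.1)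

theorem smul_mem_feasibleMeasures {F : Finset X} {r : ℝ} (hr : 0 < r) {w : X →₀ ℝ}
    (hw : w ∈ feasibleMeasures F) : r • w ∈ feasibleMeasures F :=
  ⟨smul_ne_zero hr.ne' hw.1, Finsupp.support_smul.trans hw.2.1,
    fun x => mul_nonneg hr.le (hw.2.2 x)⟩

theorem single_mem_feasibleMeasures {F : Finset X} {x : X} (hx : x ∈ F) :
    Finsupp.single x (1 : ℝ) ∈ feasibleMeasures F := by
  classical
  refine ⟨by simp, Finsupp.support_single_subset.trans (by simpa using hx), fun y => ?_⟩
  rw [Finsupp.single_apply]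
  split_ifs <;> simp

theorem mapDomain_mem_feasibleMeasures [DecidableEq X] {F : Finset X} (π : X → X) {w : X →₀ ℝ}
    (hw : w ∈ feasibleMeasures F) : w.mapDomain π ∈ feasibleMeasures (F.image π) := by
  refine ⟨ne_zero_of_totalMass_pos ?_, ?_, fun y => ?_⟩
  · rw [totalMass_mapDomain]
    exact totalMass_pos hw
  · exact Finsupp.mapDomain_support.trans (Finset.image_subset_image hw.2.1)
  · rw [Finsupp.mapDomain, Finsupp.sum_apply]
    refine Finset.sum_nonneg fun x _ => ?_
    beta_reduce
    rw [Finsupp.single_apply]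
    split_ifs
    · exact hw.2.2 x
    · exact le_rfl

theorem coe_map_subtype_subset (A : Set X) (F : Finset A) :
    ((F.map (Function.Embedding.subtype _) : Finset X) : Set X) ⊆ A := by
  intro x hx
  obtain ⟨y, -, rfl⟩ := Finset.mem_map.1 (Finset.mem_coe.1 hx)
  exact y.2

end TotalMass

section FiniteSets

variable {X : Type*} [MetricSpace X]

theorem diversityRatio_smul {r : ℝ} (hr : r ≠ 0) (w : X →₀ ℝ) :
    diversityRatio (r • w) = diversityRatio w := by
  unfold diversityRatio
  rw [totalMass_smul, similarityForm_smul_left, similarityForm_smul_right,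
    show (r * totalMass w) ^ 2 = r ^ 2 * totalMass w ^ 2 by ring,
    show r * (r * similarityForm w w) = r ^ 2 * similarityForm w w by ring]
  exact mul_div_mul_left _ _ (pow_ne_zero 2 hr)

theorem diversityRatio_single (x : X) : diversityRatio (Finsupp.single x 1) = 1 := by
  simp [diversityRatio, totalMass, similarityForm]

theorem finiteMaxDiversity_empty : finiteMaxDiversity (∅ : Finset X) = 0 := by
  simp [finiteMaxDiversity, feasibleMeasures_empty]

variable [PositiveDefiniteSpace X]

/-- By compactness of the simplex, `diversityRatio` has a maximizer. -/
theorem exists_isMaxOn_diversityRatio {F : Finset X} (hF : F.Nonempty) :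
    ∃ w ∈ feasibleMeasures F, IsMaxOn diversityRatio (feasibleMeasures F) w := by
  classical
  have : Nonempty F := hF.to_subtype
  let m : (F → ℝ) → (X →₀ ℝ) := fun g => Finsupp.indicator F fun i hi => g ⟨i, hi⟩
  have hsupp : ∀ g, (m g).support ⊆ F := fun g => Finsupp.support_indicator_subset F _
  have happ : ∀ (g : F → ℝ) (x : F), m g x = g x := fun g x =>
    Finsupp.indicator_of_mem x.2 _
  have hmass : ∀ g, totalMass (m g) = ∑ x, g x := fun g => by
    rw [totalMass_eq_sum (hsupp g), ← Finset.sum_coe_sort]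
    exact Finset.sum_congr rfl fun x _ => happ g x
  have hform : ∀ g, similarityForm (m g) (m g) =
      ∑ x : F, ∑ y : F, g x * g y * Real.exp (-dist (x : X) y) := fun g => by
    rw [similarityForm_eq_sum (hsupp g), ← Finset.sum_coe_sort]
    refine Finset.sum_congr rfl fun x _ => ?_
    rw [← Finset.sum_coe_sort]
    refine Finset.sum_congr rfl fun y _ => ?_
    rw [happ, happ]
  have hfeas : ∀ g ∈ stdSimplex ℝ F, m g ∈ feasibleMeasures F := fun g hg => by
    refine ⟨ne_zero_of_totalMass_pos (by rw [hmass, hg.2]; exact one_pos), hsupp g, fun x => ?_⟩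
    by_cases hx : x ∈ F
    · exact (hg.1 ⟨x, hx⟩).trans_eq (happ g ⟨x, hx⟩).symm
    · exact (Finsupp.indicator_of_notMem hx _).ge
  have hcont : Continuous fun g => similarityForm (m g) (m g) := by
    simp only [hform]
    fun_prop
  obtain ⟨g₀, hg₀, hmin⟩ := (isCompact_stdSimplex ℝ F).exists_isMinOn
    ⟨_, single_mem_stdSimplex ℝ (Classical.arbitrary F)⟩ hcont.continuousOn
  refine ⟨m g₀, hfeas g₀ hg₀, fun w hw => ?_⟩
  have hpos := totalMass_pos hw
  let g : F → ℝ := fun x => (totalMass w)⁻¹ * w x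
  have hmg : m g = (totalMass w)⁻¹ • w := by
    ext x
    by_cases hx : x ∈ F
    · exact happ g ⟨x, hx⟩
    · rw [Finsupp.smul_apply, Finsupp.notMem_support_iff.1 fun h => hx (hw.2.1 h), smul_zero]
      exact Finsupp.indicator_of_notMem hx _
  have hg : g ∈ stdSimplex ℝ F := by
    refine ⟨fun x => mul_nonneg (inv_nonneg.2 hpos.le) (hw.2.2 x), ?_⟩
    rw [← hmass, hmg, totalMass_smul, inv_mul_cancel₀ hpos.ne']
  change diversityRatio w ≤ diversityRatio (m g₀)
  rw [← diversityRatio_smul (inv_ne_zero hpos.ne') w, ← hmg]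
  unfold diversityRatio
  rw [hmass, hmass, hg.2, hg₀.2]
  exact div_le_div_of_nonneg_left (by norm_num)
    (similarityForm_self_pos (hfeas g₀ hg₀).1) (hmin hg)

theorem isGreatest_finiteMaxDiversity {F : Finset X} (hF : F.Nonempty) :
    IsGreatest (diversityRatio '' feasibleMeasures F) (finiteMaxDiversity F) := by
  obtain ⟨w, hw, hmax⟩ := exists_isMaxOn_diversityRatio hF
  have h : IsGreatest (diversityRatio '' feasibleMeasures F) (diversityRatio w) :=
    ⟨mem_image_of_mem _ hw, by rintro _ ⟨v, hv, rfl⟩; exact hmax hv⟩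
  rwa [finiteMaxDiversity, h.csSup_eq]

theorem diversityRatio_le_finiteMaxDiversity {F : Finset X} {w : X →₀ ℝ}
    (hw : w ∈ feasibleMeasures F) : diversityRatio w ≤ finiteMaxDiversity F :=
  (isGreatest_finiteMaxDiversity (nonempty_of_mem_feasibleMeasures hw)).2 (mem_image_of_mem _ hw)

theorem totalMass_sq_le {F : Finset X} {w : X →₀ ℝ} (hw : w ∈ feasibleMeasures F) :
    totalMass w ^ 2 ≤ finiteMaxDiversity F * similarityForm w w :=
  (div_le_iff₀ (similarityForm_self_pos hw.1)).1 (diversityRatio_le_finiteMaxDiversity hw)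

theorem one_le_finiteMaxDiversity {F : Finset X} (hF : F.Nonempty) :
    1 ≤ finiteMaxDiversity F := by
  obtain ⟨x, hx⟩ := hF
  exact (diversityRatio_single x).symm.trans_le
    (diversityRatio_le_finiteMaxDiversity (single_mem_feasibleMeasures hx))

theorem finiteMaxDiversity_nonneg (F : Finset X) : 0 ≤ finiteMaxDiversity F := by
  rcases F.eq_empty_or_nonempty with rfl | hF
  · rw [finiteMaxDiversity_empty]
  · exact zero_le_one.trans (one_le_finiteMaxDiversity hF)

theorem finiteMaxDiversity_mono {F G : Finset X} (h : F ⊆ G) :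
    finiteMaxDiversity F ≤ finiteMaxDiversity G := by
  rcases F.eq_empty_or_nonempty with rfl | hF
  · rw [finiteMaxDiversity_empty]
    exact finiteMaxDiversity_nonneg G
  · obtain ⟨w, hw, he⟩ := (isGreatest_finiteMaxDiversity hF).1
    rw [← he]
    exact diversityRatio_le_finiteMaxDiversity (feasibleMeasures_mono h hw)

theorem exists_isFiniteDiversifier {F : Finset X} (hF : F.Nonempty) :
    ∃ w, IsFiniteDiversifier F w := by
  obtain ⟨w, hw, hmax⟩ := exists_isMaxOn_diversityRatio hF
  have hr : 0 < finiteMaxDiversity F / totalMass w :=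
    div_pos (zero_lt_one.trans_le (one_le_finiteMaxDiversity hF)) (totalMass_pos hw)
  refine ⟨(finiteMaxDiversity F / totalMass w) • w, smul_mem_feasibleMeasures hr hw,
    fun v hv => ?_, ?_⟩
  · change diversityRatio v ≤ diversityRatio _
    rw [diversityRatio_smul hr.ne']
    exact hmax hv
  · rw [totalMass_smul, div_mul_cancel₀ _ (totalMass_pos hw).ne']

theorem IsFiniteDiversifier.similarityForm_self {F : Finset X} {w : X →₀ ℝ}
    (hw : IsFiniteDiversifier F w) : similarityForm w w = finiteMaxDiversity F := by
  obtain ⟨hf, hmax, hm⟩ := hw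
  have hpos := totalMass_pos hf
  have hq := similarityForm_self_pos hf.1
  have h : diversityRatio w = finiteMaxDiversity F := by
    refine (diversityRatio_le_finiteMaxDiversity hf).antisymm ?_
    obtain ⟨v, hv, he⟩ :=
      (isGreatest_finiteMaxDiversity (nonempty_of_mem_feasibleMeasures hf)).1
    rw [← he]
    exact hmax hv
  rw [diversityRatio, ← hm, div_eq_iff hq.ne', sq] at h
  rw [← hm]
  exact (mul_left_cancel₀ hpos.ne' h).symm

/-- Testing the sum of the diversifiers of `F ⊆ G` against the maximality of the second bounds
their distance. -/
theorem IsFiniteDiversifier.similarityForm_sub_le {F G : Finset X} (h : F ⊆ G) {u v : X →₀ ℝ}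
    (hu : IsFiniteDiversifier F u) (hv : IsFiniteDiversifier G v) :
    similarityForm (u - v) (u - v) ≤ 2 * (finiteMaxDiversity G - finiteMaxDiversity F) := by
  have hs := totalMass_sq_le (add_mem_feasibleMeasures (feasibleMeasures_mono h hu.1) hv.1)
  have hG : 0 < finiteMaxDiversity G := hv.2.2 ▸ totalMass_pos hv.1
  rw [totalMass_add, hu.2.2, hv.2.2, similarityForm_add_self, hu.similarityForm_self,
    hv.similarityForm_self] at hs
  rw [similarityForm_sub_self, hu.similarityForm_self, hv.similarityForm_self]
  refine le_of_mul_le_mul_left ?_ hG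
  nlinarith [sq_nonneg (finiteMaxDiversity G - finiteMaxDiversity F)]

theorem existsUnique_isFiniteDiversifier {F : Finset X} (hF : F.Nonempty) :
    ∃! w : X →₀ ℝ, IsFiniteDiversifier F w := by
  obtain ⟨w, hw⟩ := exists_isFiniteDiversifier hF
  refine ⟨w, hw, fun v hv => ?_⟩
  by_contra hne
  have h := hv.similarityForm_sub_le subset_rfl hw
  rw [sub_self, mul_zero] at h
  exact h.not_gt (similarityForm_self_pos (sub_ne_zero.2 hne))

theorem isFiniteDiversifier_finiteDiversifier {F : Finset X} (hF : F.Nonempty) :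
    IsFiniteDiversifier F (finiteDiversifier F) := by
  have h := exists_isFiniteDiversifier hF
  rw [finiteDiversifier, dif_pos h]
  exact h.choose_spec

theorem norm_toWeightingSpace_sub_sq (u v : X →₀ ℝ) :
    ‖toWeightingSpace u - toWeightingSpace v‖ ^ 2 = similarityForm (u - v) (u - v) := by
  unfold toWeightingSpace
  rw [← UniformSpace.Completion.coe_sub, UniformSpace.Completion.norm_coe,
    ← real_inner_self_eq_norm_sq]
  rfl

theorem norm_finiteDiversifier_sub_sq_le {F G : Finset X} (hF : F.Nonempty) (h : F ⊆ G) :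
    ‖toWeightingSpace (finiteDiversifier F) - toWeightingSpace (finiteDiversifier G)‖ ^ 2 ≤
      2 * (finiteMaxDiversity G - finiteMaxDiversity F) := by
  rw [norm_toWeightingSpace_sub_sq]
  exact (isFiniteDiversifier_finiteDiversifier hF).similarityForm_sub_le h
    (isFiniteDiversifier_finiteDiversifier (hF.mono h))

/-- If `F` lies in the `r`-neighbourhood of `A`, its maximum diversity exceeds that of some finite
subset of `A` by a factor of at most `e^{2r}`. -/
theorem exists_finiteMaxDiversity_le_exp_mul {F : Finset X} {A : Set X} {r : ℝ}
    (h : ∀ x ∈ F, ∃ y ∈ A, dist x y ≤ r) :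
    ∃ G : Finset X, (G : Set X) ⊆ A ∧
      finiteMaxDiversity F ≤ Real.exp (2 * r) * finiteMaxDiversity G := by
  classical
  rcases F.eq_empty_or_nonempty with rfl | hF
  · exact ⟨∅, by simp, by simp [finiteMaxDiversity_empty]⟩
  have h' : ∀ x, ∃ y, x ∈ F → y ∈ A ∧ dist x y ≤ r := fun x => by
    by_cases hx : x ∈ F
    · obtain ⟨y, hy⟩ := h x hx
      exact ⟨y, fun _ => hy⟩
    · exact ⟨x, fun hx' => (hx hx').elim⟩
  choose π hπ using h'
  refine ⟨F.image π, ?_, ?_⟩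
  · intro y hy
    obtain ⟨x, hx, rfl⟩ := Finset.mem_image.1 (Finset.mem_coe.1 hy)
    exact (hπ x hx).1
  obtain ⟨w, hw⟩ := exists_isFiniteDiversifier hF
  have hpos : 0 < finiteMaxDiversity F := hw.2.2 ▸ totalMass_pos hw.1
  have h₁ := totalMass_sq_le (mapDomain_mem_feasibleMeasures π hw.1)
  have h₂ := similarityForm_mapDomain_le (r := r) hw.1.2.2 fun x hx => (hπ x (hw.1.2.1 hx)).2
  rw [totalMass_mapDomain, hw.2.2] at h₁
  rw [hw.similarityForm_self] at h₂
  have h₃ := h₁.trans (mul_le_mul_of_nonneg_left h₂ (finiteMaxDiversity_nonneg _))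
  refine le_of_mul_le_mul_right ?_ hpos
  linarith

end FiniteSets

section CompactSets

variable {X : Type*} [MetricSpace X]

theorem ofReal_finiteMaxDiversity_le {A : Set X} {F : Finset X} (hF : (F : Set X) ⊆ A) :
    ENNReal.ofReal (finiteMaxDiversity F) ≤ maxDiversity A :=
  le_iSup₂ (f := fun (F : Finset X) (_ : (F : Set X) ⊆ A) =>
    ENNReal.ofReal (finiteMaxDiversity F)) F hF

theorem finiteMaxDiversity_le_toReal {A : Set X} (hA : maxDiversity A < ∞) {F : Finset X}
    (hF : (F : Set X) ⊆ A) : finiteMaxDiversity F ≤ (maxDiversity A).toReal :=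
  (ENNReal.ofReal_le_iff_le_toReal hA.ne).1 (ofReal_finiteMaxDiversity_le hF)

theorem exists_dist_le_hausdorffDist {A B : Set X} (hA : IsCompact A) (hB : IsCompact B)
    (hB' : B.Nonempty) {x : X} (hx : x ∈ A) : ∃ y ∈ B, dist x y ≤ Metric.hausdorffDist A B := by
  obtain ⟨y, hy, he⟩ := hB.exists_infDist_eq_dist hB' x
  refine ⟨y, hy, he ▸ Metric.infDist_le_hausdorffDist_of_mem hx ?_⟩
  exact Metric.hausdorffEDist_ne_top_of_nonempty_of_bounded ⟨x, hx⟩ hB' hA.isBounded hB.isBounded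

variable [PositiveDefiniteSpace X]

theorem maxDiversity_le_exp_mul {A B : Set X} {r : ℝ} (h : ∀ x ∈ B, ∃ y ∈ A, dist x y ≤ r) :
    maxDiversity B ≤ ENNReal.ofReal (Real.exp (2 * r)) * maxDiversity A := by
  refine iSup₂_le fun F hF => ?_
  obtain ⟨G, hG, hle⟩ := exists_finiteMaxDiversity_le_exp_mul fun x hx => h x (hF hx)
  calc ENNReal.ofReal (finiteMaxDiversity F)
      ≤ ENNReal.ofReal (Real.exp (2 * r) * finiteMaxDiversity G) := ENNReal.ofReal_le_ofReal hle
    _ = ENNReal.ofReal (Real.exp (2 * r)) * ENNReal.ofReal (finiteMaxDiversity G) :=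
        ENNReal.ofReal_mul (Real.exp_pos _).le
    _ ≤ _ := by
        gcongr
        exact ofReal_finiteMaxDiversity_le hG

theorem toReal_maxDiversity_le_exp_mul {A B : Set X} (hA : maxDiversity A < ∞) {r : ℝ}
    (h : ∀ x ∈ B, ∃ y ∈ A, dist x y ≤ r) :
    (maxDiversity B).toReal ≤ Real.exp (2 * r) * (maxDiversity A).toReal := by
  have := ENNReal.toReal_mono (ENNReal.mul_ne_top ENNReal.ofReal_ne_top hA.ne)
    (maxDiversity_le_exp_mul h)
  rwa [ENNReal.toReal_mul, ENNReal.toReal_ofReal (Real.exp_pos _).le] at this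

theorem maxDiversity_coe_finset_lt_top (T : Finset X) : maxDiversity (T : Set X) < ∞ :=
  (iSup₂_le fun _ hF => ENNReal.ofReal_le_ofReal
    (finiteMaxDiversity_mono (Finset.coe_subset.1 hF))).trans_lt ENNReal.ofReal_lt_top

theorem maxDiversity_lt_top {A : Set X} (hA : IsCompact A) : maxDiversity A < ∞ := by
  obtain ⟨t, -, hfin, ht⟩ := hA.finite_cover_balls one_pos
  lift t to Finset X using hfin
  refine (maxDiversity_le_exp_mul (A := t) (r := 1) fun x hx => ?_).trans_lt
    (ENNReal.mul_lt_top ENNReal.ofReal_lt_top (maxDiversity_coe_finset_lt_top t))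
  obtain ⟨y, hy, hxy⟩ := mem_iUnion₂.1 (ht hx)
  exact ⟨y, hy, (Metric.mem_ball.1 hxy).le⟩

theorem one_le_toReal_maxDiversity {A : Set X} (hA : maxDiversity A < ∞) (hne : A.Nonempty) :
    1 ≤ (maxDiversity A).toReal := by
  obtain ⟨x, hx⟩ := hne
  exact (one_le_finiteMaxDiversity (Finset.singleton_nonempty x)).trans
    (finiteMaxDiversity_le_toReal hA (by simpa using hx))

theorem tendsto_finiteMaxDiversity {A : Set X} (hA : maxDiversity A < ∞) :
    Tendsto (fun F : Finset A => finiteMaxDiversity (F.map (Function.Embedding.subtype _)))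
      atTop (𝓝 (maxDiversity A).toReal) := by
  refine tendsto_atTop_isLUB
    (fun F G h => finiteMaxDiversity_mono (Finset.map_subset_map.2 h)) ⟨?_, fun b hb => ?_⟩
  · rintro _ ⟨F, rfl⟩
    exact finiteMaxDiversity_le_toReal hA (coe_map_subtype_subset A F)
  · have hb' : ∀ F : Finset X, (F : Set X) ⊆ A → finiteMaxDiversity F ≤ b := fun F hF => by
      classical
      have h := hb ⟨F.subtype (· ∈ A), rfl⟩
      have e : (F.subtype (· ∈ A)).map (Function.Embedding.subtype _) = F :=
        Finset.subtype_map_of_mem fun x hx => hF hx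
      simpa only [e] using h
    have hb0 : 0 ≤ b := by simpa [finiteMaxDiversity_empty] using hb' ∅ (by simp)
    exact ENNReal.toReal_le_of_le_ofReal hb0
      (iSup₂_le fun F hF => ENNReal.ofReal_le_ofReal (hb' F hF))

theorem norm_diversifierNet_sub_sq_le {A : Set X} (hA : maxDiversity A < ∞) {F G : Finset A}
    (hF : F.Nonempty) (h : F ⊆ G) :
    ‖diversifierNet A F - diversifierNet A G‖ ^ 2 ≤ 2 * ((maxDiversity A).toReal -
      finiteMaxDiversity (F.map (Function.Embedding.subtype _))) := by
  refine (norm_finiteDiversifier_sub_sq_le (hF.map) (Finset.map_subset_map.2 h)).trans ?_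
  have := finiteMaxDiversity_le_toReal hA (coe_map_subtype_subset A G)
  linarith

theorem tendsto_diversifierNet {A : Set X} (hA : maxDiversity A < ∞) (hne : A.Nonempty) :
    Tendsto (diversifierNet A) atTop (𝓝 (diversifier A)) := by
  classical
  have : Nonempty A := hne.to_subtype
  refine tendsto_nhds_limUnder (cauchySeq_tendsto_of_complete ?_)
  rw [Metric.cauchySeq_iff']
  intro ε hε
  have hev := ((tendsto_finiteMaxDiversity hA).eventually
    (lt_mem_nhds (sub_lt_self _ (half_pos (pow_pos hε 2))))).and
    (eventually_ge_atTop ({Classical.arbitrary A} : Finset A))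
  obtain ⟨F, hF, hF'⟩ := hev.exists
  refine ⟨F, fun G hG => ?_⟩
  have h := norm_diversifierNet_sub_sq_le hA ((Finset.singleton_nonempty _).mono hF') hG
  rw [dist_comm, dist_eq_norm]
  refine lt_of_pow_lt_pow_left₀ 2 hε.le (h.trans_lt ?_)
  linarith

theorem norm_diversifier_sub_sq_le {A C : Set X} (hAC : A ⊆ C) (hA : A.Nonempty)
    (hC : maxDiversity C < ∞) :
    ‖diversifier A - diversifier C‖ ^ 2 ≤
      2 * ((maxDiversity C).toReal - (maxDiversity A).toReal) := by
  classical
  have hA' : maxDiversity A < ∞ :=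
    (iSup₂_le fun F hF => ofReal_finiteMaxDiversity_le (hF.trans hAC)).trans_lt hC
  have hne : Nonempty A := hA.to_subtype
  have hev : ∀ᶠ F in (atTop : Filter (Finset A)), ‖diversifierNet A F - diversifier C‖ ^ 2 ≤
      2 * ((maxDiversity C).toReal -
        finiteMaxDiversity (F.map (Function.Embedding.subtype _))) := by
    filter_upwards [eventually_ge_atTop ({Classical.arbitrary A} : Finset A)] with F hF
    let F' : Finset C := F.map (Set.embeddingOfSubset A C hAC)
    have hF' : F'.map (Function.Embedding.subtype _) =
        F.map (Function.Embedding.subtype _) := by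
      rw [Finset.map_map]
      rfl
    have hnet : diversifierNet A F = diversifierNet C F' := by
      rw [diversifierNet, diversifierNet, hF']
    rw [hnet, ← hF']
    refine le_of_tendsto ((tendsto_const_nhds.sub
      (tendsto_diversifierNet hC (hA.mono hAC))).norm.pow 2) ?_
    filter_upwards [eventually_ge_atTop F'] with G hG
    exact norm_diversifierNet_sub_sq_le hC
      (((Finset.singleton_nonempty _).mono hF).map) hG
  exact le_of_tendsto_of_tendsto
    (((tendsto_diversifierNet hA' hA).sub tendsto_const_nhds).norm.pow 2)
    ((tendsto_const_nhds.sub (tendsto_finiteMaxDiversity hA')).const_mul 2) hev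

theorem norm_diversifier_sub_le_of_subset {A C : Set X} (hAC : A ⊆ C) (hA : A.Nonempty)
    (hC : maxDiversity C < ∞) {r : ℝ} (hr : 0 ≤ r) (h : ∀ x ∈ C, ∃ y ∈ A, dist x y ≤ r) :
    ‖diversifier A - diversifier C‖ ≤ 2 * (maxDiversity C).toReal * √r := by
  have hA' : maxDiversity A < ∞ :=
    (iSup₂_le fun F hF => ofReal_finiteMaxDiversity_le (hF.trans hAC)).trans_lt hC
  have h₁ := norm_diversifier_sub_sq_le hAC hA hC
  have h₂ := toReal_maxDiversity_le_exp_mul hA' h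
  have h₃ := one_le_toReal_maxDiversity hC (hA.mono hAC)
  have h₄ : (1 - 2 * r) * (maxDiversity C).toReal ≤ (maxDiversity A).toReal := by
    have h₅ : 1 - 2 * r ≤ Real.exp (-(2 * r)) := Real.one_sub_le_exp_neg _
    calc (1 - 2 * r) * (maxDiversity C).toReal
        ≤ Real.exp (-(2 * r)) * (Real.exp (2 * r) * (maxDiversity A).toReal) := by gcongr
      _ = (maxDiversity A).toReal := by
          rw [← mul_assoc, ← Real.exp_add, neg_add_cancel, Real.exp_zero, one_mul]
  refine le_of_sq_le_sq ?_ (by positivity)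
  rw [mul_pow, Real.sq_sqrt hr]
  have h₆ : (maxDiversity C).toReal * r ≤ (maxDiversity C).toReal ^ 2 * r := by
    gcongr
    nlinarith
  nlinarith

theorem norm_diversifier_sub_le (A B : NonemptyCompacts X) :
    ‖diversifier (A : Set X) - diversifier (B : Set X)‖ ≤
      4 * √2 * (maxDiversity ((A : Set X) ∪ (B : Set X))).toReal *
        Metric.hausdorffDist (A : Set X) (B : Set X) ^ (1 / 2 : ℝ) := by
  have hC := maxDiversity_lt_top (A.isCompact.union B.isCompact)
  have hr : 0 ≤ Metric.hausdorffDist (A : Set X) (B : Set X) := Metric.hausdorffDist_nonneg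
  have h₁ := norm_diversifier_sub_le_of_subset subset_union_left A.nonempty hC hr (by
    rintro x (hx | hx)
    · exact ⟨x, hx, by rwa [dist_self]⟩
    · rw [Metric.hausdorffDist_comm]
      exact exists_dist_le_hausdorffDist B.isCompact A.isCompact A.nonempty hx)
  have h₂ := norm_diversifier_sub_le_of_subset subset_union_right B.nonempty hC hr (by
    rintro x (hx | hx)
    · exact exists_dist_le_hausdorffDist A.isCompact B.isCompact B.nonempty hx
    · exact ⟨x, hx, by rwa [dist_self]⟩)
  have h₃ := norm_sub_le_norm_sub_add_norm_sub (diversifier (A : Set X))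
    (diversifier ((A : Set X) ∪ (B : Set X))) (diversifier (B : Set X))
  rw [norm_sub_rev (diversifier ((A : Set X) ∪ (B : Set X)))] at h₃
  rw [← Real.sqrt_eq_rpow]
  have h₄ : (1 : ℝ) ≤ √2 := Real.one_le_sqrt.2 one_le_two
  calc _ ≤ 4 * 1 * (maxDiversity ((A : Set X) ∪ (B : Set X))).toReal *
        √(Metric.hausdorffDist (A : Set X) (B : Set X)) := by linarith
    _ ≤ _ := by gcongr

theorem toReal_maxDiversity_union_le {A B C : NonemptyCompacts X} {r : ℝ} (hB : dist B A ≤ r)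
    (hC : dist C A ≤ r) :
    (maxDiversity ((B : Set X) ∪ (C : Set X))).toReal ≤
      Real.exp (2 * r) * (maxDiversity (A : Set X)).toReal := by
  refine toReal_maxDiversity_le_exp_mul (maxDiversity_lt_top A.isCompact) ?_
  rintro x (hx | hx)
  · obtain ⟨y, hy, h⟩ := exists_dist_le_hausdorffDist B.isCompact A.isCompact A.nonempty hx
    exact ⟨y, hy, h.trans hB⟩
  · obtain ⟨y, hy, h⟩ := exists_dist_le_hausdorffDist C.isCompact A.isCompact A.nonempty hx
    exact ⟨y, hy, h.trans hC⟩

/-- Since `maxDiversity` is locally bounded, the diversifier is locally Hölder continuous. -/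
theorem exists_holderOnWith_diversifier (A : NonemptyCompacts X) :
    ∃ C : ℝ≥0, ∃ U ∈ 𝓝 A,
      HolderOnWith C (1 / 2) (fun B : NonemptyCompacts X => diversifier (B : Set X)) U := by
  let M : ℝ := 4 * √2 * (Real.exp (2 * 1) * (maxDiversity (A : Set X)).toReal)
  have hM : 0 ≤ M := by positivity
  refine ⟨M.toNNReal, Metric.closedBall A 1, Metric.closedBall_mem_nhds A one_pos,
    fun B hB C hC => ?_⟩
  have h : dist (diversifier (B : Set X)) (diversifier (C : Set X)) ≤
      M * dist B C ^ (1 / 2 : ℝ) := by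
    rw [dist_eq_norm]
    refine (norm_diversifier_sub_le B C).trans ?_
    refine mul_le_mul_of_nonneg_right ?_ (Real.rpow_nonneg Metric.hausdorffDist_nonneg _)
    exact mul_le_mul_of_nonneg_left (toReal_maxDiversity_union_le hB hC) (by positivity)
  rw [edist_dist, edist_dist]
  refine (ENNReal.ofReal_le_ofReal h).trans_eq ?_
  rw [ENNReal.ofReal_mul hM, ENNReal.ofReal_rpow_of_nonneg dist_nonneg (by simp)]
  simp [ENNReal.ofReal]

theorem continuous_diversifier :
    Continuous fun B : NonemptyCompacts X => diversifier (B : Set X) := by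
  refine continuous_iff_continuousAt.2 fun A => ?_
  obtain ⟨C, U, hU, h⟩ := exists_holderOnWith_diversifier A
  exact (h.continuousOn (by norm_num)).continuousAt hU

end CompactSets

/-- The space of nonempty compact subsets, `NonemptyCompacts X`, carries the Hausdorff metric.
The first four conjuncts say that the maximum diversity and the diversifier are well defined. -/
theorem mainTheorem2 {X : Type*} [MetricSpace X] [PositiveDefiniteSpace X] :
    (∀ F : Finset X, F.Nonempty →
      IsGreatest (diversityRatio '' feasibleMeasures F) (finiteMaxDiversity F)) ∧
    (∀ F : Finset X, F.Nonempty → ∃! w : X →₀ ℝ, IsFiniteDiversifier F w) ∧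
    (∀ A : NonemptyCompacts X, maxDiversity (A : Set X) < ∞) ∧
    (∀ A : NonemptyCompacts X,
      Tendsto (diversifierNet (A : Set X)) atTop (𝓝 (diversifier (A : Set X)))) ∧
    (∀ A B : NonemptyCompacts X,
      ‖diversifier (A : Set X) - diversifier (B : Set X)‖ ≤
        4 * √2 * (maxDiversity ((A : Set X) ∪ (B : Set X))).toReal *
          Metric.hausdorffDist (A : Set X) (B : Set X) ^ (1 / 2 : ℝ)) ∧
    (∀ A : NonemptyCompacts X,
      ContinuousAt (fun B : NonemptyCompacts X => maxDiversity (B : Set X)) A →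
        ContinuousAt (fun B : NonemptyCompacts X => diversifier (B : Set X)) A ∧
        ∃ C : ℝ≥0, ∃ U ∈ 𝓝 A,
          HolderOnWith C (1 / 2) (fun B : NonemptyCompacts X => diversifier (B : Set X)) U) := by
  exact ⟨fun _ => isGreatest_finiteMaxDiversity, fun _ => existsUnique_isFiniteDiversifier,
    fun A => maxDiversity_lt_top A.isCompact,
    fun A => tendsto_diversifierNet (maxDiversity_lt_top A.isCompact) A.nonempty,
    norm_diversifier_sub_le,
    fun A _ => ⟨continuous_diversifier.continuousAt, exists_holderOnWith_diversifier A⟩⟩
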